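/- Setting. There are $n\ge 2$ agents with values in $[0,1]$, drawn independently from a continuous distribution with value function (inverse distribution function) $v(q)$, $q\in[0,1]$. They take part in a first-price rank-based auction with position weights $1\ge w_1\ge\dots\ge w_n\ge 0$, not all equal: the agent with the $k$-th highest bid is served with probability $w_k$ (ties are broken uniformly at random) and pays his bid if served. Let $b(q)\ge 0$ be the bid of an agent of quantile $q$ in a symmetric Bayes–Nash equilibrium (with nonnegative bids); $v$ and $b$ are strictly increasing and continuously differentiable on $[0,1]$. Let $x(q)$ be the interim allocation probability of quantile $q$, let $R(q)=v(q)(1-q)$ be the revenue curve, and let $g$ be the density of the bid distribution, that is, of the law of $b(Q)$ with $Q$ uniform on $[0,1]$. From $N$ independent samples of the bid distribution, sorted as $b_{(1)}\le\dots\le b_{(N)}$, put $\hat b(q)=b_{(i)}$ for $q\in[(i-1)/N,i/N)$. Given an estimator $\hat g=\hat g_N$ of $g$ that is a jointly measurable function of the samples and of the bid, put $\hat b'(q)=1/\hat g(\hat b(q))$, $\hat v(q)=\hat b(q)+\frac{x(q)}{x'(q)}\hat b'(q)$ and $\hat R(q)=(1-q)\hat v(q)$. The mean squared error is $\mathrm{MSE}_{R(q)}(N)=E[(\hat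 R(q)-R(q))^2]^{1/2}$. Let $K>0$, $0<\kappa<1$ and $[\alpha,\beta]\subset(0,1)$. Suppose that $\hat g$ has convergence rate $r_N$, where $r_N\to\infty$ and $r_N/\sqrt N\to0$: for all large $N$, $E[\sup_z|\hat g(z)-g(z)|^2]^{1/2}\le K/r_N$, the supremum being over the bids $z=b(q)$, $0<q<1$. Suppose also that, uniformly over $q\in[\alpha,\beta]$, too small density estimates are negligible: $$E\big[\hat g(\hat b(q))^{-2}\,\mathbf 1\{\hat g(\hat b(q))<\kappa\, g(\hat b(q))\}\big]^{1/2}=o(1/r_N)$$ with $0^{-1}=\infty$ (this holds for instance if always $\hat g\ge\kappa g$). Theorem. There are constants $c,C>0$ that depend only on $K$ and $\kappa$ such that, for every such auction, value distribution, equilibrium, estimator, rate and interval $[\alpha,\beta]$, there is an $N_0$ such that the following holds for all $N\ge N_0$, every function $\epsilon$ (which may depend on $N$) and every $q\in[\alpha,\beta]$ with $\epsilon(q)>0$. If $$\frac{C\,|x''(q)|}{\sqrt N\,\epsilon(q)}\le x'(q)\le c\,x(q)\,r_N\,\epsilon(q)\qquad\text{and}\qquad N\ge\frac12\Big(\frac{v'(q)}{\epsilon(q)}\Big)^2,$$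 then the relative error of the estimated revenue curve satisfies $$\frac{\mathrm{MSE}_{R(q)}(N)}{R(q)}\le\epsilon(q).$$ -/

import Mathlib

open MeasureTheory Set Filter Topology

namespace FirstPrice

noncomputable section

/-- Position weights of a rank-based auction with `n` agents: the agent that is outbid by exactly
`k` others is served with probability `w k`, for `k = 0, …, n - 1` (only these entries matter).
They are not all equal, which makes the allocation rule strictly increasing. -/
structure IsPositionWeights (n : ℕ) (w : ℕ → ℝ) : Prop where
  mem_unit : ∀ k, k < n → 0 ≤ w k ∧ w k ≤ 1
  antitone : ∀ k, k + 1 < n → w (k + 1) ≤ w k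
  not_const : w (n - 1) < w 0

/-- `v` is the value function (inverse distribution function, on quantiles `[0, 1]`) of a
continuous distribution on `[0, 1]`: monotone, invertible and continuously differentiable. -/
structure IsValueFunction (v : ℝ → ℝ) : Prop where
  mem_unit : ∀ q ∈ Icc (0 : ℝ) 1, 0 ≤ v q ∧ v q ≤ 1
  strictMono : StrictMonoOn v (Icc 0 1)
  smooth : ContDiffOn ℝ 1 v (Icc 0 1)

/-- The law of the bid `b Q` of an agent whose quantile `Q` is uniform on `[0, 1]`. -/
def bidLaw (b : ℝ → ℝ) : Measure ℝ := (volume.restrict (Icc (0 : ℝ) 1)).map b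

/-- Rank-based allocation to a bid `z` against the opposing bids `o`; ties are broken uniformly
at random. -/
def rankAlloc (w : ℕ → ℝ) {m : ℕ} (z : ℝ) (o : Fin m → ℝ) : ℝ :=
  (∑ i ∈ Finset.range ((Finset.univ.filter fun j => o j = z).card + 1),
      w ((Finset.univ.filter fun j => z < o j).card + i)) /
    ((Finset.univ.filter fun j => o j = z).card + 1)

/-- Interim allocation of the bid `z` when the other `n - 1` agents draw independent values and
all use the bid function `b`. -/
def interimAlloc (n : ℕ) (w : ℕ → ℝ) (b : ℝ → ℝ) (z : ℝ) : ℝ :=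
  ∫ o, rankAlloc w z o ∂(Measure.pi fun _ : Fin (n - 1) => bidLaw b)

/-- Interim payment of the bid `z` in the first-price format. -/
def interimPay (n : ℕ) (w : ℕ → ℝ) (b : ℝ → ℝ) (z : ℝ) : ℝ := z * interimAlloc n w b z

/-- Interim utility of an agent with value `u` who bids `z`. -/
def utility (n : ℕ) (w : ℕ → ℝ) (b : ℝ → ℝ) (u z : ℝ) : ℝ :=
  u * interimAlloc n w b z - interimPay n w b z

/-- `b` (bid as a function of the quantile) is a symmetric Bayes-Nash equilibrium in nonnegative
bids of the first-price rank-based auction, and is monotone, invertible and continuously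
differentiable. -/
structure IsEquilibrium (n : ℕ) (w : ℕ → ℝ) (v b : ℝ → ℝ) : Prop where
  nonneg : ∀ q ∈ Icc (0 : ℝ) 1, 0 ≤ b q
  strictMono : StrictMonoOn b (Icc 0 1)
  smooth : ContDiffOn ℝ 1 b (Icc 0 1)
  bestResponse : ∀ q ∈ Icc (0 : ℝ) 1, ∀ z : ℝ, 0 ≤ z →
    utility n w b (v q) z ≤ utility n w b (v q) (b q)

/-- The allocation rule in quantile space. -/
def alloc (n : ℕ) (w : ℕ → ℝ) (b : ℝ → ℝ) (q : ℝ) : ℝ := interimAlloc n w b (b q)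

/-- The revenue curve, at quantiles strictly between `0` and `1`. -/
def revenue (v : ℝ → ℝ) (q : ℝ) : ℝ := v q * (1 - q)

/-- The bid density: derivative of the distribution function of the bids. -/
def bidDensity (b : ℝ → ℝ) (z : ℝ) : ℝ := deriv (fun t => (bidLaw b).real (Iic t)) z

/-- The law of `N` independent samples from the bid distribution. -/
def sampleLaw (b : ℝ → ℝ) (N : ℕ) : Measure (Fin N → ℝ) := Measure.pi fun _ => bidLaw b

/-- The estimated bid function: the `i`-th smallest sample on `[i - 1, i) / N`. -/
def bidEst {N : ℕ} (s : Fin N → ℝ) (q : ℝ) : ℝ :=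
  if h : ⌊q * N⌋₊ < N then s (Tuple.sort s ⟨⌊q * N⌋₊, h⟩) else 0

/-- An estimator of the bid density: from `N` samples to a function of the bid. -/
abbrev DensityEstimator : Type := (N : ℕ) → (Fin N → ℝ) → ℝ → ℝ

/-- Estimated derivative of the bid function. -/
def bidDerivEst (γ : DensityEstimator) {N : ℕ} (s : Fin N → ℝ) (q : ℝ) : ℝ :=
  1 / γ N s (bidEst s q)

/-- Estimated value function. -/
def valueEst (n : ℕ) (w : ℕ → ℝ) (b : ℝ → ℝ) (γ : DensityEstimator) {N : ℕ}
    (s : Fin N → ℝ) (q : ℝ) : ℝ :=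
  bidEst s q + alloc n w b q / deriv (alloc n w b) q * bidDerivEst γ s q

/-- Estimated revenue curve. -/
def revenueEst (n : ℕ) (w : ℕ → ℝ) (b : ℝ → ℝ) (γ : DensityEstimator) {N : ℕ}
    (s : Fin N → ℝ) (q : ℝ) : ℝ :=
  valueEst n w b γ s q * (1 - q)

/-- The mean squared error `E[(R̂(q) - R(q))²]^{1/2}` of the estimated revenue curve (possibly
`∞`). -/
def revenueMSE (n : ℕ) (w : ℕ → ℝ) (v b : ℝ → ℝ) (γ : DensityEstimator) (N : ℕ) (q : ℝ) :
    ENNReal :=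
  eLpNorm (fun s : Fin N → ℝ => revenueEst n w b γ s q - revenue v q) 2 (sampleLaw b N)

/-- The uniform error `E[sup |ĝ - g|²]^{1/2}` of a density estimator over the bids that occur. -/
def densityMSE (b : ℝ → ℝ) (γ : DensityEstimator) (N : ℕ) : ENNReal :=
  (∫⁻ s, (⨆ z ∈ b '' Ioo 0 1, ‖γ N s z - bidDensity b z‖ₑ) ^ 2 ∂(sampleLaw b N)) ^ (1 / 2 : ℝ)

/-- `E[ĝ(b̂(q))⁻² ; ĝ(b̂(q)) < κ g(b̂(q))]^{1/2}`, with `0⁻¹ = ∞`: the contribution to the second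
moment of `1 / ĝ(b̂(q))` of the event that the density estimate is too small. -/
def smallDensityMoment (κ : ℝ) (b : ℝ → ℝ) (γ : DensityEstimator) (N : ℕ) (q : ℝ) : ENNReal :=
  (∫⁻ s in {s : Fin N → ℝ | γ N s (bidEst s q) < κ * bidDensity b (bidEst s q)},
    (‖γ N s (bidEst s q)‖ₑ⁻¹) ^ 2 ∂(sampleLaw b N)) ^ (1 / 2 : ℝ)

/-- `γ` estimates the bid density at rate `r`: `r N → ∞`, `r N / √N → 0`, the uniform mean squared
error is `O(1 / r N)` with constant `K`, and, uniformly over the quantiles in `[α, β]`, too small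
density estimates contribute only `o(1 / r N)` to the root mean square of `1 / ĝ(b̂(q))`. -/
structure HasRate (K κ : ℝ) (b : ℝ → ℝ) (γ : DensityEstimator) (r : ℕ → ℝ) (α β : ℝ) :
    Prop where
  measurable : ∀ N, Measurable fun p : (Fin N → ℝ) × ℝ => γ N p.1 p.2
  rate_atTop : Tendsto r atTop atTop
  rate_slow : Tendsto (fun N : ℕ => r N / √(N : ℝ)) atTop (𝓝 0)
  error_le : ∀ᶠ N in atTop, densityMSE b γ N ≤ ENNReal.ofReal (K / r N)
  small_negligible : Tendsto
    (fun N => ENNReal.ofReal (r N) * ⨆ q ∈ Icc α β, smallDensityMoment κ b γ N q) atTop (𝓝 0)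

end

end FirstPrice

namespace FirstPrice

/-! Since `b` is strictly increasing, ties have probability zero and the interim allocation is a
polynomial $x$ in the quantile (`winProb`). The first-order condition of the equilibrium then reads
$v=b+\rho\,b'$ with $\rho=x/x'$ (`bid_add_eq_value`), and the bid density satisfies
$g(b(u))=1/b'(u)$ (`bidDensity_eq`).

Let $u$ be the true quantile of the estimated bid $\hat b(q)$. The value error splits as
$(b(u)-b(q))+\rho\,(1/\hat g-b'(u))+\rho\,(b'(u)-b'(q))$. The outer terms are $O(|u-q|)$, and
Hoeffding's inequality for the order statistic makes $|u-q|$ of size $1/\sqrt N=o(1/r_N)$ in mean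
square (`eLpNorm_quantileEst_sub_le`). In the middle term, wherever $\hat g\ge\kappa g$, the
reciprocal costs a factor $b'(u)^2/\kappa$, comparable to $b'(q)^2$ for $u$ near $q$. So the leading
error is of order $\rho\,b'(q)^2K/r_N$.

The condition $x'\le c\,x\,r_N\,\epsilon$ says $1/r_N\le c\rho\epsilon$, so the leading error is at
most a constant times $cK(\rho b')^2\epsilon$. As $\rho b'=v-b\le v\le1$, this is at most $\epsilon
v/4$ for a $c$ depending only on $K$ and $\kappa$. The remaining terms are $o(1/r_N)$ uniformly on
$[\alpha,\beta]$, where $\rho$ is bounded and $v\ge v(\alpha)>0$, so they also fit in the budget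
$\epsilon v$ for large $N$ (`error_budget`). -/

/-- A continuous strictly increasing bid function. -/
structure IsBidFunction (b : ℝ → ℝ) : Prop where
  strictMono : StrictMonoOn b (Icc 0 1)
  continuousOn : ContinuousOn b (Icc 0 1)

theorem IsEquilibrium.isBidFunction {n : ℕ} {w : ℕ → ℝ} {v b : ℝ → ℝ}
    (h : IsEquilibrium n w v b) : IsBidFunction b :=
  ⟨h.strictMono, h.smooth.continuousOn⟩

/-- The distribution function of the bids. -/
noncomputable def bidCDF (b : ℝ → ℝ) (t : ℝ) : ℝ := (bidLaw b).real (Iic t)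

/-! ### The bid law, its distribution function and its density. -/

section BidLaw

variable {b : ℝ → ℝ}

theorem IsBidFunction.aemeasurable (h : IsBidFunction b) :
    AEMeasurable b (volume.restrict (Icc (0 : ℝ) 1)) :=
  h.continuousOn.aemeasurable measurableSet_Icc

theorem IsBidFunction.isProbabilityMeasure (h : IsBidFunction b) :
    IsProbabilityMeasure (bidLaw b) := by
  have : IsProbabilityMeasure (volume.restrict (Icc (0 : ℝ) 1)) := ⟨by simp⟩
  exact Measure.isProbabilityMeasure_map h.aemeasurable

theorem IsBidFunction.bidLaw_apply (h : IsBidFunction b) {s : Set ℝ} (hs : MeasurableSet s) :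
    bidLaw b s = volume (b ⁻¹' s ∩ Icc 0 1) := by
  rw [bidLaw, Measure.map_apply_of_aemeasurable h.aemeasurable hs,
    Measure.restrict_apply' measurableSet_Icc]

theorem IsBidFunction.nullSingletonClass (h : IsBidFunction b) : NullSingletonClass (bidLaw b) := by
  refine ⟨fun z => ?_⟩
  rw [h.bidLaw_apply (measurableSet_singleton z)]
  refine Set.Subsingleton.measure_zero ?_ _
  intro x hx y hy
  exact h.strictMono.injOn hx.2 hy.2 (hx.1.trans hy.1.symm)

theorem IsBidFunction.bidCDF_apply (h : IsBidFunction b) {u : ℝ} (hu : u ∈ Icc (0 : ℝ) 1) :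
    bidCDF b (b u) = u := by
  have : b ⁻¹' Iic (b u) ∩ Icc 0 1 = Icc 0 u := by
    ext x
    simp only [mem_inter_iff, mem_preimage, mem_Iic, mem_Icc]
    constructor
    · rintro ⟨h1, h2⟩
      exact ⟨h2.1, (h.strictMono.le_iff_le h2 hu).1 h1⟩
    · rintro ⟨h1, h2⟩
      have hx : x ∈ Icc (0 : ℝ) 1 := ⟨h1, h2.trans hu.2⟩
      exact ⟨(h.strictMono.le_iff_le hx hu).2 h2, hx⟩
  rw [bidCDF, measureReal_def, h.bidLaw_apply measurableSet_Iic, this, Real.volume_Icc, sub_zero,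
    ENNReal.toReal_ofReal hu.1]

theorem IsBidFunction.monotone_bidCDF (h : IsBidFunction b) : Monotone (bidCDF b) := by
  have := h.isProbabilityMeasure
  exact fun s t hst => measureReal_mono (Iic_subset_Iic.2 hst)

theorem IsBidFunction.ae_mem_image (h : IsBidFunction b) :
    ∀ᵐ z ∂(bidLaw b), z ∈ b '' Ioo 0 1 := by
  have hae : ∀ᵐ z ∂(bidLaw b), z ∈ Ioo (b 0) (b 1) := by
    refine (ae_map_iff h.aemeasurable (p := fun z => z ∈ Ioo (b 0) (b 1)) measurableSet_Ioo).2 ?_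
    have : ∀ᵐ x ∂(volume.restrict (Icc (0 : ℝ) 1)), x ∈ Ioo (0 : ℝ) 1 := by
      rw [← restrict_Ioo_eq_restrict_Icc]
      exact ae_restrict_mem measurableSet_Ioo
    filter_upwards [this] with x hx
    have hx' := Ioo_subset_Icc_self hx
    exact ⟨h.strictMono (by simp) hx' hx.1, h.strictMono hx' (by simp) hx.2⟩
  filter_upwards [hae] with z hz
  exact intermediate_value_Ioo zero_le_one h.continuousOn hz

theorem IsBidFunction.image_Ioo_mem_nhds (h : IsBidFunction b) {s t u : ℝ} (hs : 0 ≤ s)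
    (ht : t ≤ 1) (hu : u ∈ Ioo s t) : b '' Ioo s t ∈ 𝓝 (b u) := by
  have hsub : Icc s t ⊆ Icc (0 : ℝ) 1 := Icc_subset_Icc hs ht
  have hst := hu.1.trans hu.2
  have hiv := intermediate_value_Ioo hst.le (h.continuousOn.mono hsub)
  refine Filter.mem_of_superset (Ioo_mem_nhds ?_ ?_) hiv
  · exact h.strictMono (hsub ⟨le_rfl, hst.le⟩) (hsub ⟨hu.1.le, hu.2.le⟩) hu.1
  · exact h.strictMono (hsub ⟨hu.1.le, hu.2.le⟩) (hsub ⟨hst.le, le_rfl⟩) hu.2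

/-- A monotone function whose range fills a neighbourhood of its value cannot jump there. -/
theorem IsBidFunction.continuousAt_bidCDF (h : IsBidFunction b) {u : ℝ}
    (hu : u ∈ Ioo (0 : ℝ) 1) : ContinuousAt (bidCDF b) (b u) := by
  refine continuousAt_of_monotoneOn_of_image_mem_nhds (h.monotone_bidCDF.monotoneOn univ)
    univ_mem ?_
  rw [h.bidCDF_apply (Ioo_subset_Icc_self hu)]
  refine Filter.mem_of_superset (Ioo_mem_nhds hu.1 hu.2) fun x hx => ?_
  exact ⟨b x, mem_univ _, h.bidCDF_apply (Ioo_subset_Icc_self hx)⟩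

/-- Near `b u` the distribution function inverts `b`, so the inverse function rule applies. -/
theorem IsBidFunction.bidDensity_apply (h : IsBidFunction b) {u d : ℝ}
    (hu : u ∈ Ioo (0 : ℝ) 1) (hd : HasDerivAt b d u) (hd0 : d ≠ 0) :
    bidDensity b (b u) = d⁻¹ := by
  have hF := h.bidCDF_apply (Ioo_subset_Icc_self hu)
  refine (HasDerivAt.of_local_left_inverse (g := bidCDF b) (f := b)
    (h.continuousAt_bidCDF hu) (by rwa [hF]) hd0 ?_).deriv
  filter_upwards [h.image_Ioo_mem_nhds le_rfl le_rfl hu] with y hy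
  obtain ⟨x, hx, rfl⟩ := hy
  rw [h.bidCDF_apply (Ioo_subset_Icc_self hx)]

end BidLaw

/-! ### The allocation rule as a polynomial in the quantile. -/

/-- The expectation of `w k`, where `k` is the number of failures in `m` independent trials with
success probability `q`. -/
def winProb : ℕ → (ℕ → ℝ) → ℝ → ℝ
  | 0, w, _ => w 0
  | m + 1, w, q => q * winProb m w q + (1 - q) * winProb m (fun k => w (k + 1)) q

theorem contDiff_winProb (m : ℕ) (w : ℕ → ℝ) {k : WithTop ℕ∞} : ContDiff ℝ k (winProb m w) := by
  induction m generalizing w with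
  | zero => exact contDiff_const
  | succ m ih =>
    exact (contDiff_id.mul (ih w)).add ((contDiff_const.sub contDiff_id).mul (ih _))

theorem winProb_sub (m : ℕ) (w w' : ℕ → ℝ) (q : ℝ) :
    winProb m (fun k => w k - w' k) q = winProb m w q - winProb m w' q := by
  induction m generalizing w w' with
  | zero => rfl
  | succ m ih => simp only [winProb]; rw [ih, ih]; ring

/-- The derivative rule for Bernstein polynomials: the coefficients become consecutive drops of the
weights, which makes the sign of $x'$ visible. -/
theorem hasDerivAt_winProb (m : ℕ) (w : ℕ → ℝ) (q : ℝ) :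
    HasDerivAt (winProb m w) (m * winProb (m - 1) (fun k => w k - w (k + 1)) q) q := by
  induction m generalizing w with
  | zero => exact (hasDerivAt_const q (w 0)).congr_deriv (by simp)
  | succ m ih =>
    have h := ((hasDerivAt_id q).mul (ih w)).add
      (((hasDerivAt_id q).const_sub 1).mul (ih (fun k => w (k + 1))))
    refine h.congr_deriv ?_
    have hs := winProb_sub m w (fun k => w (k + 1)) q
    -- The recursion unfolds at degree `m` only once `m` is zero or a successor.
    cases m with
    | zero => simp [winProb]; ring
    | succ m =>
      simp only [Nat.add_sub_cancel, winProb, id] at hs ⊢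
      push_cast
      linear_combination (-1 : ℝ) * hs

theorem winProb_nonneg {m : ℕ} {w : ℕ → ℝ} (hw : ∀ k ≤ m, 0 ≤ w k) {q : ℝ}
    (hq : q ∈ Icc (0 : ℝ) 1) : 0 ≤ winProb m w q := by
  induction m generalizing w with
  | zero => exact hw 0 le_rfl
  | succ m ih =>
    exact add_nonneg (mul_nonneg hq.1 (ih fun k hk => hw k (by omega)))
      (mul_nonneg (sub_nonneg.2 hq.2) (ih fun k hk => hw (k + 1) (by omega)))

theorem winProb_pos {m : ℕ} {w : ℕ → ℝ} (hw : ∀ k ≤ m, 0 ≤ w k) {k : ℕ} (hk : k ≤ m)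
    (hwk : 0 < w k) {q : ℝ} (hq : q ∈ Ioo (0 : ℝ) 1) : 0 < winProb m w q := by
  induction m generalizing w k with
  | zero => obtain rfl : k = 0 := by omega
            exact hwk
  | succ m ih =>
    have hq' := Ioo_subset_Icc_self hq
    have h1 : ∀ k ≤ m, 0 ≤ w k := fun k hk => hw k (by omega)
    have h2 : ∀ k ≤ m, 0 ≤ w (k + 1) := fun k hk => hw (k + 1) (by omega)
    have hq1 : 0 < 1 - q := sub_pos.2 hq.2
    cases k with
    | zero =>
      exact add_pos_of_pos_of_nonneg (mul_pos hq.1 (ih h1 (Nat.zero_le m) hwk))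
        (mul_nonneg hq1.le (winProb_nonneg h2 hq'))
    | succ k =>
      exact add_pos_of_nonneg_of_pos (mul_nonneg hq.1.le (winProb_nonneg h1 hq'))
        (mul_pos hq1 (ih h2 (by omega) hwk))

namespace IsPositionWeights

variable {n : ℕ} {w : ℕ → ℝ}

theorem winProb_pos (hw : IsPositionWeights n w) (hn : 2 ≤ n) {q : ℝ}
    (hq : q ∈ Ioo (0 : ℝ) 1) : 0 < winProb (n - 1) w q :=
  FirstPrice.winProb_pos (fun k hk => (hw.mem_unit k (by omega)).1) (Nat.zero_le _)
    ((hw.mem_unit (n - 1) (by omega)).1.trans_lt hw.not_const) hq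

theorem exists_lt (hw : IsPositionWeights n w) (hn : 2 ≤ n) :
    ∃ k ≤ n - 1 - 1, w (k + 1) < w k := by
  by_contra! h
  have : ∀ k ≤ n - 1, w 0 ≤ w k := by
    intro k
    induction k with
    | zero => exact fun _ => le_rfl
    | succ k ih => exact fun hk => (ih (by omega)).trans (h k (by omega))
  exact (this (n - 1) le_rfl).not_gt hw.not_const

theorem deriv_winProb_pos (hw : IsPositionWeights n w) (hn : 2 ≤ n) {q : ℝ}
    (hq : q ∈ Ioo (0 : ℝ) 1) : 0 < deriv (winProb (n - 1) w) q := by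
  rw [(hasDerivAt_winProb _ _ _).deriv]
  obtain ⟨k, hk, hlt⟩ := hw.exists_lt hn
  refine mul_pos (by exact_mod_cast (by omega : 0 < n - 1)) ?_
  exact FirstPrice.winProb_pos (fun j hj => sub_nonneg.2 (hw.antitone j (by omega))) hk
    (sub_pos.2 hlt) hq

end IsPositionWeights

/-! ### From the random opposing bids to the polynomial. -/

section Count

variable {m : ℕ} {w : ℕ → ℝ} {z : ℝ}

theorem measurable_card_filter_lt :
    Measurable fun o : Fin m → ℝ => (Finset.univ.filter fun j => z < o j).card := by
  simp only [Finset.card_filter]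
  refine Finset.measurable_fun_sum _ fun j _ => Measurable.ite ?_ measurable_const measurable_const
  exact measurableSet_lt measurable_const (measurable_pi_apply j)

theorem integrable_count (μ : Measure (Fin m → ℝ)) [IsFiniteMeasure μ] :
    Integrable (fun o : Fin m → ℝ => w (Finset.univ.filter fun j => z < o j).card) μ := by
  refine Integrable.of_bound
    ((measurable_from_nat (f := w)).comp measurable_card_filter_lt).aestronglyMeasurable
    (∑ k ∈ Finset.range (m + 1), |w k|) (ae_of_all _ fun o => ?_)
  refine Finset.single_le_sum (f := fun k => |w k|) (fun k _ => abs_nonneg _) ?_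
  rw [Finset.mem_range, Nat.lt_succ_iff]
  simpa using Finset.card_filter_le (Finset.univ : Finset (Fin m)) fun j => z < o j

/-- Conditioning on one opponent reproduces the recursion of `winProb`: with probability `μ.real
(Iic z)` that opponent does not outbid `z`, otherwise the weights shift by one. -/
theorem integral_count (μ : Measure ℝ) [IsProbabilityMeasure μ] :
    ∫ o, w (Finset.univ.filter fun j => z < o j).card ∂(Measure.pi fun _ : Fin m => μ) =
      winProb m w (μ.real (Iic z)) := by
  induction m generalizing w with
  | zero => simp [winProb]
  | succ m ih =>
    have hmp := (measurePreserving_piFinSuccAbove (fun _ : Fin (m + 1) => μ) 0).symm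
    have hsplit : ∀ p : ℝ × (Fin m → ℝ),
        w (Finset.univ.filter fun j =>
          z < ((MeasurableEquiv.piFinSuccAbove (fun _ => ℝ) (0 : Fin (m + 1))).symm p) j).card =
        if p.1 ≤ z then w (Finset.univ.filter fun j => z < p.2 j).card
        else w ((Finset.univ.filter fun j => z < p.2 j).card + 1) := by
      intro p
      rw [Fin.card_filter_univ_succ']
      by_cases hp : p.1 ≤ z
      · simp [hp, MeasurableEquiv.piFinSuccAbove, Fin.insertNthEquiv, not_lt.2 hp]
      · simp [hp, MeasurableEquiv.piFinSuccAbove, Fin.insertNthEquiv, not_le.1 hp, add_comm]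
    have hint := hmp.integrable_comp_of_integrable
      (integrable_count (w := w) (z := z) (Measure.pi fun _ : Fin (m + 1) => μ))
    rw [← hmp.integral_comp (MeasurableEquiv.measurableEmbedding _)]
    rw [Function.comp_def] at hint
    simp only [hsplit] at hint ⊢
    rw [integral_prod _ hint]
    have hinner : ∀ x : ℝ,
        ∫ y, (if x ≤ z then w (Finset.univ.filter fun j => z < y j).card
          else w ((Finset.univ.filter fun j => z < y j).card + 1))
          ∂(Measure.pi fun _ : Fin m => μ) =
        winProb m (fun k => w (k + 1)) (μ.real (Iic z)) +
          (Iic z).indicator (fun _ => winProb m w (μ.real (Iic z)) -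
            winProb m (fun k => w (k + 1)) (μ.real (Iic z))) x := by
      intro x
      by_cases hx : x ≤ z
      · simp only [hx, if_true, indicator_of_mem (mem_Iic.2 hx)]
        rw [ih]; ring
      · simp only [hx, if_false]
        rw [indicator_of_notMem (by simpa using hx), add_zero, ← ih]
    simp only [hinner]
    rw [integral_add (integrable_const _) ((integrable_const _).indicator measurableSet_Iic),
      integral_indicator measurableSet_Iic]
    simp only [integral_const, smul_eq_mul, winProb, probReal_univ, measureReal_restrict_apply_univ]
    ring

theorem rankAlloc_of_ne {o : Fin m → ℝ} (h : ∀ j, o j ≠ z) :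
    rankAlloc w z o = w (Finset.univ.filter fun j => z < o j).card := by
  simp [rankAlloc, h]

theorem interimAlloc_eq {n : ℕ} {b : ℝ → ℝ} (hb : IsBidFunction b) {z : ℝ} :
    interimAlloc n w b z = winProb (n - 1) w (bidCDF b z) := by
  have := hb.isProbabilityMeasure
  have := hb.nullSingletonClass
  rw [bidCDF, ← integral_count, interimAlloc]
  refine integral_congr_ae ?_
  have : ∀ᵐ o ∂(Measure.pi fun _ : Fin (n - 1) => bidLaw b), ∀ j, o j ≠ z := by
    refine ae_all_iff.2 fun j => ?_
    refine (Measure.quasiMeasurePreserving_eval (fun _ : Fin (n - 1) => bidLaw b) j).ae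
      (p := fun x => x ≠ z) ?_
    simp [ae_iff]
  filter_upwards [this] with o ho using rankAlloc_of_ne ho

theorem alloc_eq {n : ℕ} {b : ℝ → ℝ} (hb : IsBidFunction b) {q : ℝ} (hq : q ∈ Icc (0 : ℝ) 1) :
    alloc n w b q = winProb (n - 1) w q := by
  rw [alloc, interimAlloc_eq hb, hb.bidCDF_apply hq]

theorem deriv_alloc_eq {n : ℕ} {b : ℝ → ℝ} (hb : IsBidFunction b) {q : ℝ}
    (hq : q ∈ Ioo (0 : ℝ) 1) :
    deriv (alloc n w b) q = deriv (winProb (n - 1) w) q := by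
  refine Filter.EventuallyEq.deriv_eq ?_
  filter_upwards [Ioo_mem_nhds hq.1 hq.2] with x hx using alloc_eq hb (Ioo_subset_Icc_self hx)

end Count

/-! ### The first-order condition of the equilibrium. -/

section Equilibrium

variable {n : ℕ} {w : ℕ → ℝ} {v b : ℝ → ℝ}

theorem IsEquilibrium.le (h : IsEquilibrium n w v b) {q u : ℝ}
    (hq : q ∈ Icc (0 : ℝ) 1) (hu : u ∈ Icc (0 : ℝ) 1) :
    (v q - b u) * winProb (n - 1) w u ≤ (v q - b q) * winProb (n - 1) w q := by
  have := h.bestResponse q hq (b u) (h.nonneg u hu)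
  have hb := h.isBidFunction
  simp only [utility, interimPay, interimAlloc_eq hb, hb.bidCDF_apply hq,
    hb.bidCDF_apply hu] at this
  linarith

/-- Bidding zero is never a loss, so quantile `q / 2` does not bid above its value. Imitating it
gives the larger value `v q` a strictly positive utility, hence the equilibrium utility at `q` is
positive too. -/
theorem IsEquilibrium.bid_lt_value (hn : 2 ≤ n) (hw : IsPositionWeights n w)
    (hv : IsValueFunction v) (h : IsEquilibrium n w v b) {q : ℝ} (hq : q ∈ Ioo (0 : ℝ) 1) :
    b q < v q := by
  have hu : q / 2 ∈ Ioo (0 : ℝ) 1 := ⟨by linarith [hq.1], by linarith [hq.1, hq.2]⟩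
  have hq' := Ioo_subset_Icc_self hq
  have hu' := Ioo_subset_Icc_self hu
  have hb := h.isBidFunction
  have hpu := hw.winProb_pos hn hu
  have hpq := hw.winProb_pos hn hq
  have hle : b (q / 2) ≤ v (q / 2) := by
    have := h.bestResponse _ hu' 0 le_rfl
    simp only [utility, interimPay, interimAlloc_eq hb, hb.bidCDF_apply hu'] at this
    have h0 : 0 ≤ winProb (n - 1) w (bidCDF b 0) := by
      have := hb.isProbabilityMeasure
      exact winProb_nonneg (fun k hk => (hw.mem_unit k (by omega)).1)
        ⟨measureReal_nonneg, measureReal_le_one⟩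
    have h1 : 0 ≤ v (q / 2) * winProb (n - 1) w (bidCDF b 0) :=
      mul_nonneg (hv.mem_unit _ hu').1 h0
    have h2 : 0 ≤ (v (q / 2) - b (q / 2)) * winProb (n - 1) w (q / 2) := by linarith
    linarith [nonneg_of_mul_nonneg_left h2 hpu]
  have hlt : v (q / 2) < v q := hv.strictMono hu' hq' (by linarith [hq.1])
  have h3 := h.le hq' hu'
  have h4 : 0 < (v q - b (q / 2)) * winProb (n - 1) w (q / 2) := mul_pos (by linarith) hpu
  linarith [pos_of_mul_pos_left (h4.trans_le h3) hpq.le]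

/-- The derivative of the equilibrium bid function. -/
noncomputable def bidSlope (n : ℕ) (w : ℕ → ℝ) (v b : ℝ → ℝ) (q : ℝ) : ℝ :=
  (v q - b q) * deriv (winProb (n - 1) w) q / winProb (n - 1) w q

/-- The payoff of quantile `q` from imitating quantile `u` is maximal at `u = q`, so its derivative
in `u` vanishes there. -/
theorem IsEquilibrium.hasDerivAt (hn : 2 ≤ n) (hw : IsPositionWeights n w)
    (h : IsEquilibrium n w v b) {q : ℝ} (hq : q ∈ Ioo (0 : ℝ) 1) :
    HasDerivAt b (bidSlope n w v b q) q := by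
  have hd : HasDerivAt b (deriv b q) q :=
    ((h.smooth.contDiffAt (Icc_mem_nhds hq.1 hq.2)).differentiableAt (by simp)).hasDerivAt
  have hp : HasDerivAt (winProb (n - 1) w) (deriv (winProb (n - 1) w) q) q :=
    ((contDiff_winProb (n - 1) w (k := 1)).differentiable (by simp) q).hasDerivAt
  have hmax : IsLocalMax (fun u => (v q - b u) * winProb (n - 1) w u) q := by
    filter_upwards [Ioo_mem_nhds hq.1 hq.2] with u hu
    exact h.le (Ioo_subset_Icc_self hq) (Ioo_subset_Icc_self hu)
  have hz := hmax.hasDerivAt_eq_zero ((hd.const_sub (v q)).mul hp)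
  have hpq := hw.winProb_pos hn hq
  convert hd using 1
  rw [bidSlope, div_eq_iff hpq.ne']
  linarith

theorem IsEquilibrium.bidSlope_pos (hn : 2 ≤ n) (hw : IsPositionWeights n w)
    (hv : IsValueFunction v) (h : IsEquilibrium n w v b) {q : ℝ} (hq : q ∈ Ioo (0 : ℝ) 1) :
    0 < bidSlope n w v b q :=
  div_pos (mul_pos (sub_pos.2 (h.bid_lt_value hn hw hv hq)) (hw.deriv_winProb_pos hn hq))
    (hw.winProb_pos hn hq)

theorem IsEquilibrium.bidDensity_eq (hn : 2 ≤ n) (hw : IsPositionWeights n w)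
    (hv : IsValueFunction v) (h : IsEquilibrium n w v b) {q : ℝ} (hq : q ∈ Ioo (0 : ℝ) 1) :
    bidDensity b (b q) = (bidSlope n w v b q)⁻¹ :=
  h.isBidFunction.bidDensity_apply hq (h.hasDerivAt hn hw hq) (h.bidSlope_pos hn hw hv hq).ne'

theorem IsEquilibrium.exists_bidSlope_le (hn : 2 ≤ n) (hw : IsPositionWeights n w)
    (h : IsEquilibrium n w v b) :
    ∃ B, 0 < B ∧ ∀ q ∈ Ioo (0 : ℝ) 1, bidSlope n w v b q ≤ B := by
  have hc : ContinuousOn (derivWithin b (Icc 0 1)) (Icc 0 1) :=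
    h.smooth.continuousOn_derivWithin (uniqueDiffOn_Icc zero_lt_one) le_rfl
  obtain ⟨B, hB⟩ := isCompact_Icc.exists_bound_of_continuousOn hc
  refine ⟨max B 1, by simp, fun q hq => le_max_of_le_left ?_⟩
  have := hB q (Ioo_subset_Icc_self hq)
  rw [derivWithin_of_mem_nhds (Icc_mem_nhds hq.1 hq.2), (h.hasDerivAt hn hw hq).deriv] at this
  exact (le_abs_self _).trans this

/-- The first-order condition gains regularity: it expresses $b'$ through $v$, $b$ and a polynomial,
so $b'$ is itself $C^1$ in the interior and can be Lipschitz there. -/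
theorem IsEquilibrium.contDiffOn_bidSlope (hn : 2 ≤ n) (hw : IsPositionWeights n w)
    (hv : IsValueFunction v) (h : IsEquilibrium n w v b) :
    ContDiffOn ℝ 1 (bidSlope n w v b) (Ioo 0 1) := by
  refine ContDiffOn.div (ContDiffOn.mul ?_ ?_) (contDiff_winProb _ _).contDiffOn
    fun q hq => (hw.winProb_pos hn hq).ne'
  · exact (hv.smooth.mono Ioo_subset_Icc_self).sub (h.smooth.mono Ioo_subset_Icc_self)
  · exact ((contDiff_succ_iff_deriv (n := 1)).1 (contDiff_winProb (n - 1) w)).2.2.contDiffOn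

end Equilibrium

/-! ### Concentration of the empirical quantile. -/

section OrderStatistic

variable {N : ℕ} {q : ℝ}

/-- The sorted samples are indexed from zero, hence the strict inequality for the count. -/
theorem bidEst_le_iff (hq : ⌊q * N⌋₊ < N) (s : Fin N → ℝ) (t : ℝ) :
    bidEst s q ≤ t ↔ ⌊q * N⌋₊ < (Finset.univ.filter fun j => s j ≤ t).card := by
  have h := Tuple.lt_card_le_iff_apply_le_of_monotone (a := t) (j := ⟨⌊q * N⌋₊, hq⟩)
    (Tuple.monotone_sort s)
  have hc : (Finset.univ.filter fun j => (s ∘ Tuple.sort s) j ≤ t).card =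
      (Finset.univ.filter fun j => s j ≤ t).card := by
    refine Finset.card_equiv (Tuple.sort s) fun j => by simp
  rw [hc] at h
  rw [bidEst, dif_pos hq]
  exact h.symm

theorem bidEst_mem {S : Set ℝ} (hq : ⌊q * N⌋₊ < N) {s : Fin N → ℝ} (hs : ∀ j, s j ∈ S) :
    bidEst s q ∈ S := by
  rw [bidEst, dif_pos hq]
  exact hs _

theorem card_filter_eq_sum_indicator (s : Fin N → ℝ) (t : ℝ) :
    ((Finset.univ.filter fun j => s j ≤ t).card : ℝ) =
      ∑ j, (Iic t).indicator (fun _ => (1 : ℝ)) (s j) := by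
  simp [indicator_apply]

theorem measurable_bidEst (hq : ⌊q * N⌋₊ < N) :
    Measurable fun s : Fin N → ℝ => bidEst s q := by
  refine measurable_of_Iic fun t => ?_
  have : (fun s : Fin N → ℝ => bidEst s q) ⁻¹' Iic t =
      {s | (⌊q * N⌋₊ : ℝ) < ∑ j, (Iic t).indicator (fun _ => (1 : ℝ)) (s j)} := by
    ext s
    rw [mem_preimage, mem_Iic, bidEst_le_iff hq, mem_ofPred_eq, ← card_filter_eq_sum_indicator,
      Nat.cast_lt]
  rw [this]
  refine measurableSet_lt measurable_const (Finset.measurable_fun_sum _ fun j _ => ?_)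
  exact (measurable_const.indicator measurableSet_Iic).comp (measurable_pi_apply j)

/-- Hoeffding's inequality: each centred summand is sub-Gaussian with variance proxy $1/4$. -/
theorem measure_sum_sub_ge_le (μ : Measure ℝ) [IsProbabilityMeasure μ] {X : ℝ → ℝ}
    (hX : Measurable X) (h01 : ∀ z, X z ∈ Icc (0 : ℝ) 1) {t : ℝ} (ht : 0 ≤ t) :
    (Measure.pi fun _ : Fin N => μ) {s | N * t ≤ ∑ j, (X (s j) - ∫ z, X z ∂μ)} ≤
      ENNReal.ofReal (Real.exp (-(2 * N) * t ^ 2)) := by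
  set P := Measure.pi fun _ : Fin N => μ
  have hind : ProbabilityTheory.iIndepFun (fun (j : Fin N) (s : Fin N → ℝ) =>
      X (s j) - ∫ z, X z ∂μ) P :=
    ProbabilityTheory.iIndepFun_pi (X := fun _ z => X z - ∫ z, X z ∂μ)
      fun _ => (hX.sub_const _).aemeasurable
  have hsub : ∀ j ∈ (Finset.univ : Finset (Fin N)), ProbabilityTheory.HasSubgaussianMGF
      (fun s : Fin N → ℝ => X (s j) - ∫ z, X z ∂μ) ((‖(1 : ℝ) - 0‖₊ / 2) ^ 2) P := by
    intro j _
    have h := ProbabilityTheory.hasSubgaussianMGF_of_mem_Icc (μ := P) (a := 0) (b := 1)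
      (X := fun s : Fin N → ℝ => X (s j)) (hX.comp (measurable_pi_apply j)).aemeasurable
      (ae_of_all _ fun s => h01 _)
    have hI : ∫ s, X (s j) ∂P = ∫ z, X z ∂μ :=
      integral_comp_eval (μ := fun _ : Fin N => μ) (i := j) hX.aestronglyMeasurable
    rwa [hI] at h
  have h := ProbabilityTheory.HasSubgaussianMGF.measure_sum_ge_le_of_iIndepFun hind hsub
    (ε := N * t) (by positivity)
  rw [← ofReal_measureReal]
  refine ENNReal.ofReal_le_ofReal (h.trans (Real.exp_le_exp.2 (le_of_eq ?_)))
  rcases Nat.eq_zero_or_pos N with rfl | hN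
  · simp
  have hN' : (N : ℝ) ≠ 0 := by positivity
  simp
  field_simp

variable {b : ℝ → ℝ}

/-- The quantile of the estimated bid. -/
noncomputable def quantileEst (b : ℝ → ℝ) {N : ℕ} (s : Fin N → ℝ) (q : ℝ) : ℝ :=
  bidCDF b (bidEst s q)

theorem IsBidFunction.measurable_quantileEst (hb : IsBidFunction b) (hq : ⌊q * N⌋₊ < N) :
    Measurable fun s : Fin N → ℝ => quantileEst b s q :=
  hb.monotone_bidCDF.measurable.comp (measurable_bidEst hq)

theorem IsBidFunction.ae_sampleLaw (hb : IsBidFunction b) (N : ℕ) :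
    ∀ᵐ s ∂(sampleLaw b N), ∀ j, s j ∈ b '' Ioo 0 1 := by
  have := hb.isProbabilityMeasure
  refine ae_all_iff.2 fun j => ?_
  exact (Measure.quasiMeasurePreserving_eval (fun _ : Fin N => bidLaw b) j).ae hb.ae_mem_image

theorem IsBidFunction.ae_quantileEst (hb : IsBidFunction b) (hq : ⌊q * N⌋₊ < N) :
    ∀ᵐ s ∂(sampleLaw b N), quantileEst b s q ∈ Ioo (0 : ℝ) 1 ∧
      bidEst s q = b (quantileEst b s q) := by
  filter_upwards [hb.ae_sampleLaw N] with s hs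
  obtain ⟨u, hu, hbu⟩ := bidEst_mem hq hs
  rw [quantileEst, ← hbu, hb.bidCDF_apply (Ioo_subset_Icc_self hu)]
  exact ⟨hu, rfl⟩

/-- On this event more than `q * N` samples lie below `b (q - t)`, where only `N * (q - t)` are
expected. -/
theorem IsBidFunction.measure_quantileEst_lt (hb : IsBidFunction b) (hq : ⌊q * N⌋₊ < N)
    {t : ℝ} (ht : 0 < t) (hq1 : q ≤ 1) :
    sampleLaw b N {s | quantileEst b s q < q - t} ≤
      ENNReal.ofReal (Real.exp (-(2 * N) * t ^ 2)) := by
  have := hb.isProbabilityMeasure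
  rcases lt_or_ge (q - t) 0 with h0 | h0
  · refine le_of_eq_of_le (measure_mono_null (t := ∅) (fun s hs => ?_) measure_empty) bot_le
    have : 0 ≤ quantileEst b s q := measureReal_nonneg
    exact absurd hs (by simp only [mem_ofPred_eq]; linarith)
  have hp : q - t ∈ Icc (0 : ℝ) 1 := ⟨h0, by linarith⟩
  set X : ℝ → ℝ := (Iic (b (q - t))).indicator fun _ => 1 with hXdef
  have hI : ∫ z, X z ∂(bidLaw b) = q - t := by
    rw [hXdef, integral_indicator measurableSet_Iic]
    simpa [measureReal_restrict_apply_univ, bidCDF] using hb.bidCDF_apply hp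
  refine (measure_mono fun s hs => ?_).trans (measure_sum_sub_ge_le (bidLaw b) (X := X)
    (measurable_const.indicator measurableSet_Iic) (fun z => ?_) ht.le)
  · simp only [mem_ofPred_eq] at hs ⊢
    have hle : bidEst s q ≤ b (q - t) := by
      by_contra! hlt
      have := hb.monotone_bidCDF hlt.le
      rw [hb.bidCDF_apply hp] at this
      exact this.not_gt hs
    rw [bidEst_le_iff hq] at hle
    have h1 := Nat.lt_floor_add_one (q * N)
    have h2 : ((⌊q * N⌋₊ : ℝ) + 1) ≤ ∑ j, X (s j) := by
      rw [← card_filter_eq_sum_indicator]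
      exact_mod_cast hle
    rw [Finset.sum_sub_distrib, hI]
    simp only [Finset.sum_const, Finset.card_univ, Fintype.card_fin, nsmul_eq_mul]
    linarith
  · by_cases hz : z ∈ Iic (b (q - t)) <;> simp [hXdef, hz]

theorem IsBidFunction.measure_lt_quantileEst (hb : IsBidFunction b) (hq : ⌊q * N⌋₊ < N)
    {t : ℝ} (ht : 0 < t) (hq0 : 0 ≤ q) :
    sampleLaw b N {s | q + t < quantileEst b s q} ≤
      ENNReal.ofReal (Real.exp (-(2 * N) * t ^ 2)) := by
  have := hb.isProbabilityMeasure
  rcases lt_or_ge 1 (q + t) with h0 | h0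
  · refine le_of_eq_of_le (measure_mono_null (t := ∅) (fun s hs => ?_) measure_empty) bot_le
    have : quantileEst b s q ≤ 1 := measureReal_le_one
    exact absurd hs (by simp only [mem_ofPred_eq]; linarith)
  have hp : q + t ∈ Icc (0 : ℝ) 1 := ⟨by linarith, h0⟩
  set X : ℝ → ℝ := fun z => 1 - (Iic (b (q + t))).indicator (fun _ => 1) z with hXdef
  have hI : ∫ z, X z ∂(bidLaw b) = 1 - (q + t) := by
    rw [hXdef, integral_sub (integrable_const _)
      ((integrable_const _).indicator measurableSet_Iic), integral_indicator measurableSet_Iic]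
    simpa [measureReal_restrict_apply_univ, bidCDF] using hb.bidCDF_apply hp
  refine (measure_mono fun s hs => ?_).trans (measure_sum_sub_ge_le (bidLaw b) (X := X)
    (measurable_const.sub (measurable_const.indicator measurableSet_Iic)) (fun z => ?_) ht.le)
  · simp only [mem_ofPred_eq] at hs ⊢
    have hle : ¬ bidEst s q ≤ b (q + t) := by
      intro hlt
      have := hb.monotone_bidCDF hlt
      rw [hb.bidCDF_apply hp] at this
      exact this.not_gt hs
    rw [bidEst_le_iff hq, not_lt] at hle
    have h1 := Nat.floor_le (mul_nonneg hq0 N.cast_nonneg)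
    have h2 : ∑ j, (Iic (b (q + t))).indicator (fun _ => (1 : ℝ)) (s j) ≤ (⌊q * N⌋₊ : ℝ) := by
      rw [← card_filter_eq_sum_indicator]
      exact_mod_cast hle
    rw [hI, hXdef]
    simp only [Finset.sum_sub_distrib, Finset.sum_const, Finset.card_univ, Fintype.card_fin,
      nsmul_eq_mul]
    linarith
  · by_cases hz : z ∈ Iic (b (q + t)) <;> simp [hXdef, hz]

theorem lintegral_exp_neg_mul_sq_mul_le {a : ℝ} (ha : 0 < a) :
    ∫⁻ t in Ioi (0 : ℝ), ENNReal.ofReal (Real.exp (-a * t ^ 2) * t) =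
      ENNReal.ofReal (1 / (2 * a)) := by
  have hd : ∀ t ∈ Ici (0 : ℝ), HasDerivAt (fun t => -(1 / (2 * a)) * Real.exp (-a * t ^ 2))
      (Real.exp (-a * t ^ 2) * t) t := by
    intro t _
    have h := (((hasDerivAt_pow 2 t).const_mul (-a)).exp).const_mul (-(1 / (2 * a)))
    refine h.congr_deriv ?_
    field_simp
    simp
  have hnn : ∀ t ∈ Ioi (0 : ℝ), 0 ≤ Real.exp (-a * t ^ 2) * t :=
    fun t ht => mul_nonneg (Real.exp_pos _).le (le_of_lt ht)
  have hlim : Tendsto (fun t : ℝ => -(1 / (2 * a)) * Real.exp (-a * t ^ 2)) atTop (𝓝 0) := by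
    rw [← mul_zero (-(1 / (2 * a)))]
    refine (Real.tendsto_exp_atBot.comp ?_).const_mul _
    exact (tendsto_pow_atTop (by norm_num)).const_mul_atTop_of_neg (neg_lt_zero.2 ha)
  have hint := integrableOn_Ioi_deriv_of_nonneg' hd hnn hlim
  rw [← ofReal_integral_eq_lintegral_ofReal hint
    ((ae_restrict_iff' measurableSet_Ioi).2 (ae_of_all _ hnn)),
    integral_Ioi_of_hasDerivAt_of_nonneg' hd hnn hlim]
  simp

/-- Layer-cake formula with the two Hoeffding tails: $2\int_0^\infty 2t\,e^{-2Nt^2}\,dt=1/N$. -/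
theorem IsBidFunction.eLpNorm_quantileEst_sub_le (hb : IsBidFunction b) (hq : ⌊q * N⌋₊ < N)
    (hN : 0 < N) (hq01 : q ∈ Icc (0 : ℝ) 1) :
    eLpNorm (fun s => quantileEst b s q - q) 2 (sampleLaw b N) ≤
      ENNReal.ofReal (1 / √N) := by
  have hm : Measurable fun s : Fin N → ℝ => |quantileEst b s q - q| :=
    ((hb.measurable_quantileEst hq).sub_const q).abs
  have hN' : (0 : ℝ) < N := by exact_mod_cast hN
  have key : ∫⁻ s, ENNReal.ofReal (|quantileEst b s q - q| ^ (2 : ℝ)) ∂(sampleLaw b N) ≤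
      ENNReal.ofReal (1 / N) := by
    rw [lintegral_rpow_eq_lintegral_meas_lt_mul _ (ae_of_all _ fun s => abs_nonneg _)
      hm.aemeasurable two_pos]
    have hle : ∀ t ∈ Ioi (0 : ℝ), sampleLaw b N {s | t < |quantileEst b s q - q|} *
        ENNReal.ofReal (t ^ ((2 : ℝ) - 1)) ≤
        2 * ENNReal.ofReal (Real.exp (-(2 * N) * t ^ 2) * t) := by
      intro t ht
      have hsub : {s : Fin N → ℝ | t < |quantileEst b s q - q|} ⊆
          {s | quantileEst b s q < q - t} ∪ {s | q + t < quantileEst b s q} := by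
        intro s hs
        simp only [mem_ofPred_eq, lt_abs] at hs
        rcases hs with h | h
        · right; simp only [mem_ofPred_eq]; linarith
        · left; simp only [mem_ofPred_eq]; linarith
      have h2 := (measure_mono hsub).trans ((measure_union_le _ _).trans
        (add_le_add (hb.measure_quantileEst_lt hq ht hq01.2)
          (hb.measure_lt_quantileEst hq ht hq01.1)))
      rw [show (2 : ℝ) - 1 = 1 by norm_num, Real.rpow_one,
        ENNReal.ofReal_mul (Real.exp_pos _).le, ← mul_assoc, two_mul]
      gcongr
    calc ENNReal.ofReal 2 * ∫⁻ t in Ioi (0 : ℝ), sampleLaw b N {s | t < |quantileEst b s q - q|} *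
          ENNReal.ofReal (t ^ ((2 : ℝ) - 1))
        ≤ ENNReal.ofReal 2 * ∫⁻ t in Ioi (0 : ℝ),
            2 * ENNReal.ofReal (Real.exp (-(2 * N) * t ^ 2) * t) := by
          gcongr 1
          exact setLIntegral_mono' measurableSet_Ioi hle
      _ = ENNReal.ofReal (1 / N) := by
          rw [lintegral_const_mul' _ _ (by simp), lintegral_exp_neg_mul_sq_mul_le (by positivity),
            show (2 : ENNReal) = ENNReal.ofReal 2 by simp, ← ENNReal.ofReal_mul (by norm_num),
            ← ENNReal.ofReal_mul (by norm_num)]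
          congr 1
          field_simp
  rw [eLpNorm_eq_lintegral_rpow_enorm_toReal (by simp) (by simp)]
  have hsq : ENNReal.ofReal (1 / √N) = ENNReal.ofReal (1 / N) ^ (1 / (2 : ENNReal).toReal) := by
    rw [ENNReal.ofReal_rpow_of_nonneg (by positivity) (by simp)]
    congr 1
    rw [ENNReal.toReal_ofNat, ← Real.sqrt_eq_rpow, Real.sqrt_div zero_le_one, Real.sqrt_one]
  rw [hsq]
  gcongr
  refine le_of_eq_of_le (lintegral_congr fun s => ?_) key
  rw [ENNReal.toReal_ofNat, Real.enorm_eq_ofReal_abs,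
    ENNReal.ofReal_rpow_of_nonneg (abs_nonneg _) (by norm_num)]

end OrderStatistic

/-! ### The error of a reciprocal density. -/

/-- Here `d` and `e` play the slopes of `b` at $u$ and $q$, and `G` the density estimate. If `G` is
not too small, `1 / G ≤ d / κ`. If it is, the density error is at least `(1 - κ) / d`, so it pays
for `d`, while `|1 / G|` is kept as a separate term. -/
theorem abs_inv_sub_le {κ G d e : ℝ} (hκ : 0 < κ) (hκ1 : κ < 1) (hd : 0 < d)
    (he : d ^ 2 ≤ 2 * e ^ 2) :
    |1 / G - d| ≤ 2 * e ^ 2 * (1 / κ + 1 / (1 - κ)) * |G - d⁻¹| +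
      (if G < κ * d⁻¹ then |1 / G| else 0) := by
  have hκ2 : 0 < 1 - κ := sub_pos.2 hκ1
  have h0 : 0 ≤ 2 * e ^ 2 * |G - d⁻¹| := by positivity
  split_ifs with h
  · have h1 : (1 - κ) * d⁻¹ ≤ |G - d⁻¹| := by
      rw [abs_sub_comm]
      exact le_trans (by linarith) (le_abs_self _)
    have h2 : d ≤ 2 * e ^ 2 * (1 / (1 - κ)) * |G - d⁻¹| := by
      calc d = d ^ 2 * (1 / (1 - κ)) * ((1 - κ) * d⁻¹) := by field_simp
        _ ≤ 2 * e ^ 2 * (1 / (1 - κ)) * |G - d⁻¹| := by gcongr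
    have h3 : 0 ≤ 2 * e ^ 2 * (1 / κ) * |G - d⁻¹| := by positivity
    have h4 : |1 / G - d| ≤ |1 / G| + d := (abs_sub _ _).trans_eq (by rw [abs_of_pos hd])
    linarith
  · have hG' : κ * d⁻¹ ≤ G := not_lt.1 h
    have hG : 0 < G := lt_of_lt_of_le (by positivity) hG'
    have h1 : |1 / G - d| = d * (1 / G) * |G - d⁻¹| := by
      rw [show 1 / G - d = d * (1 / G) * (d⁻¹ - G) by field_simp, abs_mul, abs_sub_comm,
        abs_of_pos (a := d * (1 / G)) (by positivity)]
    have h2 : 1 / G ≤ d * (1 / κ) := by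
      rw [div_le_iff₀ hG]
      calc (1 : ℝ) = d * (1 / κ) * (κ * d⁻¹) := by field_simp
        _ ≤ d * (1 / κ) * G := by gcongr
    have h3 : 0 ≤ 2 * e ^ 2 * (1 / (1 - κ)) * |G - d⁻¹| := by positivity
    have h4 : d * (1 / G) ≤ 2 * e ^ 2 * (1 / κ) := by
      calc d * (1 / G) ≤ d * (d * (1 / κ)) := by gcongr
        _ = d ^ 2 * (1 / κ) := by ring
        _ ≤ 2 * e ^ 2 * (1 / κ) := by gcongr
    rw [h1]
    have h5 := mul_le_mul_of_nonneg_right h4 (abs_nonneg (G - d⁻¹))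
    linarith

/-- A crude bound for the case where `d` is itself of order $|u-q|$. -/
theorem abs_inv_sub_le' {κ G d : ℝ} (hκ : 0 < κ) (hd : 0 < d) :
    |1 / G - d| ≤ (1 + 1 / κ) * d + (if G < κ * d⁻¹ then |1 / G| else 0) := by
  have h0 : 0 ≤ 1 / κ * d := by positivity
  have h4 : |1 / G - d| ≤ |1 / G| + d := (abs_sub _ _).trans_eq (by rw [abs_of_pos hd])
  split_ifs with h
  · linarith
  · have hG' : κ * d⁻¹ ≤ G := not_lt.1 h
    have hG : 0 < G := lt_of_lt_of_le (by positivity) hG'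
    have h2 : 1 / G ≤ d * (1 / κ) := by
      rw [div_le_iff₀ hG]
      calc (1 : ℝ) = d * (1 / κ) * (κ * d⁻¹) := by field_simp
        _ ≤ d * (1 / κ) * G := by gcongr
    rw [abs_of_pos (a := 1 / G) (by positivity)] at h4
    linarith

/-! ### Pointwise error of the estimated value. -/

section

variable {n : ℕ} {w : ℕ → ℝ} {v b : ℝ → ℝ}

/-- Bounds, uniform over the quantiles in a compact subinterval of `(0, 1)`, for the variation
of the bid function and of its derivative. -/
theorem IsEquilibrium.exists_uniform_bound (hn : 2 ≤ n) (hw : IsPositionWeights n w)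
    (hv : IsValueFunction v) (h : IsEquilibrium n w v b) {α β : ℝ} (hα : 0 < α) (hβ : β < 1) :
    ∃ L, 0 < L ∧ ∀ q ∈ Icc α β, ∀ u ∈ Ioo (0 : ℝ) 1,
      |b u - b q| ≤ L * |u - q| ∧
      |bidSlope n w v b u - bidSlope n w v b q| ≤ L * |u - q| ∧
      (bidSlope n w v b u ^ 2 ≤ 2 * bidSlope n w v b q ^ 2 ∨
        bidSlope n w v b u ≤ L * |u - q|) := by
  rcases lt_or_ge β α with hαβ | hαβ
  · exact ⟨1, one_pos, fun q hq => absurd (hq.1.trans hq.2) (not_le.2 hαβ)⟩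
  obtain ⟨L₁, hL₁⟩ := h.smooth.exists_lipschitzOnWith one_ne_zero (convex_Icc _ _) isCompact_Icc
  obtain ⟨B, hB0, hB⟩ := h.exists_bidSlope_le hn hw
  -- The slope need not be Lipschitz up to the endpoints. It is on this larger compact interval; a
  -- `u` outside it is at distance at least `δ` from `q`, and there boundedness of the slope
  -- suffices.
  have hsub : Icc (α / 2) ((1 + β) / 2) ⊆ Ioo 0 1 := fun x hx =>
    ⟨by linarith [hx.1], by linarith [hx.2]⟩
  have hsub' : Icc α β ⊆ Ioo 0 1 := fun x hx => ⟨by linarith [hx.1], by linarith [hx.2]⟩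
  obtain ⟨L₂, hL₂⟩ := ((h.contDiffOn_bidSlope hn hw hv).mono hsub).exists_lipschitzOnWith
    one_ne_zero (convex_Icc _ _) isCompact_Icc
  obtain ⟨q₀, hq₀, hmin⟩ := isCompact_Icc.exists_isMinOn (nonempty_Icc.2 hαβ)
    ((h.contDiffOn_bidSlope hn hw hv).continuousOn.mono hsub')
  set m := bidSlope n w v b q₀ with hm
  have hm0 : 0 < m := h.bidSlope_pos hn hw hv (hsub' hq₀)
  set δ := min (α / 2) ((1 - β) / 2) with hδ
  have hδ0 : 0 < δ := lt_min (by linarith) (by linarith)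
  set L₃ : ℝ := max L₂ (B / δ) with hL₃
  have hL₃0 : 0 < L₃ := lt_max_of_lt_right (by positivity)
  have hslope : ∀ q ∈ Icc α β, ∀ u ∈ Ioo (0 : ℝ) 1,
      |bidSlope n w v b u - bidSlope n w v b q| ≤ L₃ * |u - q| := by
    intro q hq u hu
    rcases le_or_gt δ |u - q| with hfar | hnear
    · have h1 := h.bidSlope_pos hn hw hv hu
      have h2 := h.bidSlope_pos hn hw hv (hsub' hq)
      have h3 := hB u hu
      have h4 := hB q (hsub' hq)
      calc |bidSlope n w v b u - bidSlope n w v b q| ≤ B := abs_sub_le_iff.2 ⟨by linarith,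
            by linarith⟩
        _ = B / δ * δ := by field_simp
        _ ≤ L₃ * |u - q| := by gcongr; exact le_max_right _ _
    · have hδ1 : δ ≤ α / 2 := min_le_left _ _
      have hδ2 : δ ≤ (1 - β) / 2 := min_le_right _ _
      have hu' : u ∈ Icc (α / 2) ((1 + β) / 2) := by
        rw [abs_lt] at hnear
        exact ⟨by linarith [hq.1], by linarith [hq.2]⟩
      have hq' : q ∈ Icc (α / 2) ((1 + β) / 2) := ⟨by linarith [hq.1], by linarith [hq.2]⟩
      have := hL₂.dist_le_mul u hu' q hq'
      rw [Real.dist_eq, Real.dist_eq] at this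
      exact this.trans (mul_le_mul_of_nonneg_right (le_max_left _ _) (abs_nonneg _))
  set L : ℝ := max (max L₁ L₃) (3 * L₃ * B / m) with hL
  refine ⟨L, lt_max_of_lt_right (by positivity), fun q hq u hu => ⟨?_, ?_, ?_⟩⟩
  · have := hL₁.dist_le_mul u (Ioo_subset_Icc_self hu) q (Ioo_subset_Icc_self (hsub' hq))
    rw [Real.dist_eq, Real.dist_eq] at this
    exact this.trans (mul_le_mul_of_nonneg_right
      ((le_max_left _ _).trans (le_max_left _ _)) (abs_nonneg _))
  · exact (hslope q hq u hu).trans (mul_le_mul_of_nonneg_right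
      ((le_max_right _ _).trans (le_max_left _ _)) (abs_nonneg _))
  · have hu0 := h.bidSlope_pos hn hw hv hu
    have hmq : m ≤ bidSlope n w v b q := hmin hq
    -- For near `u` the slope grows by at most a third, and $(4/3)^2\le2$. For far `u` the bound `B`
    -- is absorbed by `|u - q|`.
    rcases le_or_gt (3 * (L₃ * |u - q|)) m with hnear | hfar
    · left
      have h1 := (le_abs_self _).trans (hslope q hq u hu)
      have h2 : bidSlope n w v b u ≤ 4 / 3 * bidSlope n w v b q := by linarith
      calc bidSlope n w v b u ^ 2 ≤ (4 / 3 * bidSlope n w v b q) ^ 2 := by gcongr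
        _ ≤ 2 * bidSlope n w v b q ^ 2 := by nlinarith [sq_nonneg (bidSlope n w v b q)]
    · right
      calc bidSlope n w v b u ≤ B := hB u hu
        _ = B / m * m := by field_simp
        _ ≤ B / m * (3 * (L₃ * |u - q|)) := by gcongr
        _ = 3 * L₃ * B / m * |u - q| := by ring
        _ ≤ L * |u - q| := by gcongr; exact le_max_right _ _

/-- The ratio `x / x'`. -/
noncomputable def allocRatio (n : ℕ) (w : ℕ → ℝ) (q : ℝ) : ℝ :=
  winProb (n - 1) w q / deriv (winProb (n - 1) w) q

theorem IsPositionWeights.allocRatio_pos (hn : 2 ≤ n) (hw : IsPositionWeights n w) {q : ℝ}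
    (hq : q ∈ Ioo (0 : ℝ) 1) : 0 < allocRatio n w q :=
  div_pos (hw.winProb_pos hn hq) (hw.deriv_winProb_pos hn hq)

theorem IsPositionWeights.exists_allocRatio_le (hn : 2 ≤ n) (hw : IsPositionWeights n w)
    {α β : ℝ} (hα : 0 < α) (hβ : β < 1) :
    ∃ X, 0 < X ∧ ∀ q ∈ Icc α β, allocRatio n w q ≤ X := by
  have hsub' : Icc α β ⊆ Ioo 0 1 := fun x hx => ⟨by linarith [hx.1], by linarith [hx.2]⟩
  have hc : ContinuousOn (allocRatio n w) (Icc α β) :=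
    (contDiff_winProb (n - 1) w (k := 1)).continuous.continuousOn.div
      ((contDiff_winProb (n - 1) w (k := 1)).continuous_deriv le_rfl).continuousOn
      fun q hq => (hw.deriv_winProb_pos hn (hsub' hq)).ne'
  obtain ⟨X, hX⟩ := isCompact_Icc.exists_bound_of_continuousOn hc
  exact ⟨max X 1, by simp, fun q hq => le_max_of_le_left ((le_abs_self _).trans (hX q hq))⟩

theorem IsPositionWeights.bid_add_eq_value (hn : 2 ≤ n) (hw : IsPositionWeights n w) {q : ℝ}
    (hq : q ∈ Ioo (0 : ℝ) 1) : b q + allocRatio n w q * bidSlope n w v b q = v q := by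
  have h1 := (hw.winProb_pos hn hq).ne'
  have h2 := (hw.deriv_winProb_pos hn hq).ne'
  rw [allocRatio, bidSlope]
  field_simp
  ring

/-- The error of the estimated value in terms of the errors of the estimated density and of the
estimated quantile. -/
theorem abs_value_error_le {κ L X G u q : ℝ} (hκ : 0 < κ) (hκ1 : κ < 1) (hL : 0 < L)
    (hn : 2 ≤ n) (hw : IsPositionWeights n w) (hv : IsValueFunction v)
    (h : IsEquilibrium n w v b) (hu : u ∈ Ioo (0 : ℝ) 1) (hq : q ∈ Ioo (0 : ℝ) 1)
    (hX : allocRatio n w q ≤ X)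
    (h1 : |b u - b q| ≤ L * |u - q|)
    (h2 : |bidSlope n w v b u - bidSlope n w v b q| ≤ L * |u - q|)
    (h3 : bidSlope n w v b u ^ 2 ≤ 2 * bidSlope n w v b q ^ 2 ∨
      bidSlope n w v b u ≤ L * |u - q|) :
    |b u + allocRatio n w q * (1 / G) - v q| ≤
      allocRatio n w q * (2 * bidSlope n w v b q ^ 2 * (1 / κ + 1 / (1 - κ))) *
          |G - bidDensity b (b u)| +
        allocRatio n w q * (if G < κ * bidDensity b (b u) then |1 / G| else 0) +
        L * (1 + X * (2 + 1 / κ)) * |u - q| := by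
  rw [h.bidDensity_eq hn hw hv hu, ← hw.bid_add_eq_value (v := v) (b := b) hn hq]
  set d := bidSlope n w v b u
  set e := bidSlope n w v b q
  set ρ := allocRatio n w q
  set I : ℝ := if G < κ * d⁻¹ then |1 / G| else 0
  have hd : 0 < d := h.bidSlope_pos hn hw hv hu
  have hρ : 0 < ρ := hw.allocRatio_pos hn hq
  have hκ2 : 0 < 1 - κ := sub_pos.2 hκ1
  have hκ3 : 0 < 1 + 1 / κ := by positivity
  have hmain : |1 / G - d| ≤ 2 * e ^ 2 * (1 / κ + 1 / (1 - κ)) * |G - d⁻¹| + I +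
      (1 + 1 / κ) * (L * |u - q|) := by
    rcases h3 with h3 | h3
    · exact (abs_inv_sub_le hκ hκ1 hd h3).trans (le_add_of_nonneg_right (by positivity))
    · have h4 := abs_inv_sub_le' (G := G) hκ hd
      have h5 : (1 + 1 / κ) * d ≤ (1 + 1 / κ) * (L * |u - q|) := by gcongr
      have h6 : 0 ≤ 2 * e ^ 2 * (1 / κ + 1 / (1 - κ)) * |G - d⁻¹| := by positivity
      linarith
  calc |b u + ρ * (1 / G) - (b q + ρ * e)|
      = |(b u - b q) + ρ * ((1 / G - d) + (d - e))| := by congr 1; ring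
    _ ≤ |b u - b q| + ρ * (|1 / G - d| + |d - e|) := by
        refine (abs_add_le _ _).trans (add_le_add le_rfl ?_)
        rw [abs_mul, abs_of_pos hρ]
        gcongr
        exact abs_add_le _ _
    _ ≤ L * |u - q| + ρ * (2 * e ^ 2 * (1 / κ + 1 / (1 - κ)) * |G - d⁻¹| + I +
          (1 + 1 / κ) * (L * |u - q|) + L * |u - q|) := by gcongr
    _ = ρ * (2 * e ^ 2 * (1 / κ + 1 / (1 - κ))) * |G - d⁻¹| + ρ * I +
          L * (1 + ρ * (2 + 1 / κ)) * |u - q| := by ring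
    _ ≤ _ := by gcongr

end

/-! ### Mean squared error of the estimates. -/

section

variable {n : ℕ} {w : ℕ → ℝ} {v b : ℝ → ℝ} {γ : DensityEstimator}

theorem eLpNorm_density_error_le (hb : IsBidFunction b) {N : ℕ} {q : ℝ} (hq : ⌊q * N⌋₊ < N) :
    eLpNorm (fun s : Fin N → ℝ => |γ N s (bidEst s q) - bidDensity b (bidEst s q)|) 2
      (sampleLaw b N) ≤ densityMSE b γ N := by
  rw [eLpNorm_eq_lintegral_rpow_enorm_toReal (by simp) (by simp), densityMSE,
    ENNReal.toReal_ofNat]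
  gcongr 1
  refine lintegral_mono_ae ?_
  filter_upwards [hb.ae_sampleLaw N] with s hs
  rw [← Real.norm_eq_abs, enorm_norm, ENNReal.rpow_ofNat]
  gcongr
  exact le_iSup₂_of_le (bidEst s q) (bidEst_mem hq hs) le_rfl

/-- An inequality only, because at a vanishing estimate the real quotient is `0` while the extended
inverse is `∞`. -/
theorem eLpNorm_small_density_le {κ : ℝ} {N : ℕ} {q : ℝ} (hq : ⌊q * N⌋₊ < N)
    (hγ : Measurable fun p : (Fin N → ℝ) × ℝ => γ N p.1 p.2) :
    eLpNorm (fun s : Fin N → ℝ =>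
      if γ N s (bidEst s q) < κ * bidDensity b (bidEst s q) then |1 / γ N s (bidEst s q)| else 0) 2
      (sampleLaw b N) ≤ smallDensityMoment κ b γ N q := by
  have hm := measurable_bidEst hq
  have hG : Measurable fun s : Fin N → ℝ => γ N s (bidEst s q) :=
    hγ.comp (measurable_id.prodMk hm)
  have hg : Measurable fun s : Fin N → ℝ => bidDensity b (bidEst s q) :=
    (measurable_deriv _).comp hm
  rw [eLpNorm_eq_lintegral_rpow_enorm_toReal (by simp) (by simp), smallDensityMoment,
    ENNReal.toReal_ofNat, ← lintegral_indicator (measurableSet_lt hG (hg.const_mul κ))]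
  gcongr 1
  refine lintegral_mono fun s => ?_
  by_cases h : γ N s (bidEst s q) < κ * bidDensity b (bidEst s q)
  · rw [if_pos h, indicator_of_mem (by exact h), ← Real.norm_eq_abs, enorm_norm, ENNReal.rpow_ofNat, one_div]
    gcongr
    rcases eq_or_ne (γ N s (bidEst s q)) 0 with h0 | h0
    · simp [h0]
    · rw [enorm_inv h0]
  · rw [if_neg h, indicator_of_notMem (by exact h)]
    simp

theorem eLpNorm_value_error_le {κ L X q : ℝ} (hκ : 0 < κ) (hκ1 : κ < 1) (hL : 0 < L)
    (hn : 2 ≤ n) (hw : IsPositionWeights n w) (hv : IsValueFunction v)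
    (h : IsEquilibrium n w v b) (hq : q ∈ Ioo (0 : ℝ) 1) (hX : allocRatio n w q ≤ X)
    (hbd : ∀ u ∈ Ioo (0 : ℝ) 1, |b u - b q| ≤ L * |u - q| ∧
      |bidSlope n w v b u - bidSlope n w v b q| ≤ L * |u - q| ∧
      (bidSlope n w v b u ^ 2 ≤ 2 * bidSlope n w v b q ^ 2 ∨
        bidSlope n w v b u ≤ L * |u - q|))
    {N : ℕ} (hN : 0 < N) (hγ : Measurable fun p : (Fin N → ℝ) × ℝ => γ N p.1 p.2) :
    eLpNorm (fun s : Fin N → ℝ => valueEst n w b γ s q - v q) 2 (sampleLaw b N) ≤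
      ENNReal.ofReal (allocRatio n w q * (2 * bidSlope n w v b q ^ 2 * (1 / κ + 1 / (1 - κ)))) *
          densityMSE b γ N +
        ENNReal.ofReal (allocRatio n w q) * smallDensityMoment κ b γ N q +
        ENNReal.ofReal (L * (1 + X * (2 + 1 / κ))) * ENNReal.ofReal (1 / √N) := by
  have hb := h.isBidFunction
  have hN' : (0 : ℝ) < N := by exact_mod_cast hN
  have hqN : ⌊q * N⌋₊ < N := (Nat.floor_lt (mul_nonneg hq.1.le hN'.le)).2
    (by nlinarith [hq.2])
  have hm := measurable_bidEst hqN
  have hG : Measurable fun s : Fin N → ℝ => γ N s (bidEst s q) :=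
    hγ.comp (measurable_id.prodMk hm)
  have hg : Measurable fun s : Fin N → ℝ => bidDensity b (bidEst s q) :=
    (measurable_deriv _).comp hm
  have hρ := hw.allocRatio_pos hn hq
  have hκ2 : 0 < 1 - κ := sub_pos.2 hκ1
  have hX0 : 0 < X := hρ.trans_le hX
  set A := allocRatio n w q * (2 * bidSlope n w v b q ^ 2 * (1 / κ + 1 / (1 - κ)))
  have hA : 0 ≤ A := by positivity
  set M := L * (1 + X * (2 + 1 / κ))
  have hM : 0 ≤ M := by positivity
  set f₁ : (Fin N → ℝ) → ℝ := fun s => |γ N s (bidEst s q) - bidDensity b (bidEst s q)|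
  set f₂ : (Fin N → ℝ) → ℝ := fun s =>
    if γ N s (bidEst s q) < κ * bidDensity b (bidEst s q) then |1 / γ N s (bidEst s q)| else 0
  set f₃ : (Fin N → ℝ) → ℝ := fun s => quantileEst b s q - q
  have hf₁ : Measurable f₁ := (hG.sub hg).abs
  have hf₂ : Measurable f₂ :=
    Measurable.ite (measurableSet_lt hG (hg.const_mul κ)) (hG.const_div 1).abs measurable_const
  have hf₃ : Measurable f₃ := (hb.measurable_quantileEst hqN).sub_const q
  calc eLpNorm (fun s : Fin N → ℝ => valueEst n w b γ s q - v q) 2 (sampleLaw b N)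
      ≤ eLpNorm (A • f₁ + allocRatio n w q • f₂ + M • fun s => |f₃ s|) 2 (sampleLaw b N) := by
        refine eLpNorm_mono_ae ?_
        filter_upwards [hb.ae_quantileEst hqN] with s hs
        obtain ⟨hu, hbu⟩ := hs
        obtain ⟨h1, h2, h3⟩ := hbd _ hu
        have key := abs_value_error_le (G := γ N s (bidEst s q)) hκ hκ1 hL hn hw hv h hu hq hX
          h1 h2 h3
        rw [← hbu] at key
        rw [Real.norm_eq_abs, Real.norm_eq_abs, valueEst, bidDerivEst, deriv_alloc_eq hb hq,
          alloc_eq hb (Ioo_subset_Icc_self hq)]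
        exact key.trans (le_abs_self _)
    _ ≤ eLpNorm (A • f₁) 2 (sampleLaw b N) + eLpNorm (allocRatio n w q • f₂) 2 (sampleLaw b N) +
          eLpNorm (M • fun s => |f₃ s|) 2 (sampleLaw b N) := by
        have m₁ : AEStronglyMeasurable (A • f₁) (sampleLaw b N) :=
          (hf₁.const_smul A).aestronglyMeasurable
        have m₂ : AEStronglyMeasurable (allocRatio n w q • f₂) (sampleLaw b N) :=
          (hf₂.const_smul _).aestronglyMeasurable
        have m₃ : AEStronglyMeasurable (M • fun s => |f₃ s|) (sampleLaw b N) :=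
          (hf₃.abs.const_smul M).aestronglyMeasurable
        exact (eLpNorm_add_le (m₁.add m₂) m₃ one_le_two).trans
          (add_le_add (eLpNorm_add_le m₁ m₂ one_le_two) le_rfl)
    _ ≤ _ := by
        rw [eLpNorm_const_smul, eLpNorm_const_smul, eLpNorm_const_smul,
          Real.enorm_of_nonneg hA, Real.enorm_of_nonneg hρ.le, Real.enorm_of_nonneg hM]
        gcongr
        · exact eLpNorm_density_error_le hb hqN
        · exact eLpNorm_small_density_le hqN hγ
        · exact (eLpNorm_norm f₃).trans_le
            (hb.eLpNorm_quantileEst_sub_le hqN hN (Ioo_subset_Icc_self hq))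

/-- The factor `1 - q` is common to the revenue and its error, so relative errors of revenue and
value agree. -/
theorem revenueMSE_div_le {N : ℕ} {q B ε : ℝ} (hq : q < 1) (hε : 0 < ε)
    (hB : B ≤ ε * v q)
    (h : eLpNorm (fun s : Fin N → ℝ => valueEst n w b γ s q - v q) 2 (sampleLaw b N) ≤
      ENNReal.ofReal B) :
    revenueMSE n w v b γ N q / ENNReal.ofReal (revenue v q) ≤ ENNReal.ofReal ε := by
  have hq' : 0 < 1 - q := sub_pos.2 hq
  have heq : (fun s : Fin N → ℝ => revenueEst n w b γ s q - revenue v q) =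
      (1 - q) • fun s : Fin N → ℝ => valueEst n w b γ s q - v q := by
    ext s
    simp only [revenueEst, revenue, Pi.smul_apply, smul_eq_mul]
    ring
  refine ENNReal.div_le_of_le_mul ?_
  rw [revenueMSE, heq, eLpNorm_const_smul, Real.enorm_of_nonneg hq'.le,
    ← ENNReal.ofReal_mul hε.le]
  refine (mul_le_mul_right h _).trans ?_
  rw [← ENNReal.ofReal_mul hq'.le]
  refine ENNReal.ofReal_le_ofReal ?_
  rw [revenue]
  nlinarith

/-- The three contributions to the error, compared with the tolerance `ε`. -/
theorem error_budget {K κ' L' X c v₀ V r ε e ρ S : ℝ} (hK : 0 < K) (hκ' : 0 < κ')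
    (hc : c = 1 / (8 * κ' * K)) (hX : 0 < X) (hv₀ : 0 < v₀) (hv₀V : v₀ ≤ V) (hV : V ≤ 1)
    (hr : 0 < r) (he : 0 ≤ e) (hρ : 0 < ρ) (hρX : ρ ≤ X) (hL' : 0 < L') (hε : 0 < ε)
    (hS : 0 < S) (hρe : ρ * e ≤ V) (hcond : 1 ≤ c * ρ * r * ε)
    (hslow : r / S ≤ v₀ / (4 * L' * c * X)) :
    ρ * (2 * e ^ 2 * κ') * (K / r) + ρ * (v₀ / (4 * X ^ 2 * c) / r) + L' * (1 / S) ≤ ε * V := by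
  have hc0 : 0 < c := by rw [hc]; positivity
  have hinv : 1 / r ≤ c * ρ * ε := by
    rw [div_le_iff₀ hr]; linarith
  have h1 : ρ * (2 * e ^ 2 * κ') * (K / r) ≤ ε * V / 4 := by
    -- This uses $V^2\le V$, from $V\le1$; it makes `c` independent of the auction.
    have hsq : (ρ * e) ^ 2 ≤ V := by
      have : 0 ≤ ρ * e := by positivity
      nlinarith
    calc ρ * (2 * e ^ 2 * κ') * (K / r) = 2 * κ' * K * (ρ * e) ^ 2 / ρ * (1 / r) := by
          field_simp
      _ ≤ 2 * κ' * K * V / ρ * (c * ρ * ε) := by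
          have : 0 < V := hv₀.trans_le hv₀V
          gcongr
      _ = ε * V / 4 := by rw [hc]; field_simp; ring
  have h2 : ρ * (v₀ / (4 * X ^ 2 * c) / r) ≤ ε * V / 4 := by
    calc ρ * (v₀ / (4 * X ^ 2 * c) / r) = ρ * (v₀ / (4 * X ^ 2 * c)) * (1 / r) := by field_simp
      _ ≤ X * (v₀ / (4 * X ^ 2 * c)) * (c * X * ε) := by gcongr; exact hinv.trans (by gcongr)
      _ = ε * v₀ / 4 := by field_simp
      _ ≤ ε * V / 4 := by gcongr
  have h3 : L' * (1 / S) ≤ ε * V / 4 := by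
    calc L' * (1 / S) = L' * (r / S) * (1 / r) := by field_simp
      _ ≤ L' * (v₀ / (4 * L' * c * X)) * (c * X * ε) := by
          gcongr; exact hinv.trans (by gcongr)
      _ = ε * v₀ / 4 := by field_simp
      _ ≤ ε * V / 4 := by gcongr
  have : 0 < ε * V := mul_pos hε (hv₀.trans_le hv₀V)
  linarith

end

end FirstPrice

/-! ### Choice of constants and conclusion. -/

open FirstPrice in
theorem mainTheorem8 (K κ : ℝ) (hK : 0 < K) (hκ : 0 < κ) (hκ1 : κ < 1) :
    ∃ c C : ℝ, 0 < c ∧ 0 < C ∧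
      ∀ (n : ℕ) (w : ℕ → ℝ) (v b : ℝ → ℝ) (γ : FirstPrice.DensityEstimator) (r : ℕ → ℝ)
        (α β : ℝ),
        2 ≤ n → FirstPrice.IsPositionWeights n w → FirstPrice.IsValueFunction v →
        FirstPrice.IsEquilibrium n w v b → 0 < α → β < 1 →
        FirstPrice.HasRate K κ b γ r α β →
        ∃ N₀ : ℕ, ∀ N : ℕ, N₀ ≤ N → ∀ ε : ℝ → ℝ, ∀ q ∈ Set.Icc α β, 0 < ε q →
          C * |deriv (deriv (FirstPrice.alloc n w b)) q| / (√(N : ℝ) * ε q) ≤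
            deriv (FirstPrice.alloc n w b) q →
          deriv (FirstPrice.alloc n w b) q ≤ c * FirstPrice.alloc n w b q * r N * ε q →
          1 / 2 * (deriv v q / ε q) ^ 2 ≤ (N : ℝ) →
          FirstPrice.revenueMSE n w v b γ N q / ENNReal.ofReal (FirstPrice.revenue v q) ≤
            ENNReal.ofReal (ε q) := by
  have hκ2 : 0 < 1 - κ := sub_pos.2 hκ1
  have hκ' : 0 < 1 / κ + 1 / (1 - κ) := by positivity
  -- With this `c` the leading error takes exactly a quarter of the budget:
  -- $2(1/\kappa+1/(1-\kappa))Kc=1/4$.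
  refine ⟨1 / (8 * (1 / κ + 1 / (1 - κ)) * K), 1, by positivity, one_pos, ?_⟩
  set c := 1 / (8 * (1 / κ + 1 / (1 - κ)) * K) with hc
  have hc0 : 0 < c := by positivity
  intro n w v b γ r α β hn hw hv h hα hβ hrate
  rcases lt_or_ge β α with hαβ | hαβ
  · exact ⟨0, fun N _ ε q hq => absurd (hq.1.trans hq.2) (not_le.2 hαβ)⟩
  obtain ⟨L, hL, hbd⟩ := h.exists_uniform_bound hn hw hv hα hβ
  obtain ⟨X, hX, hρX⟩ := hw.exists_allocRatio_le hn hα hβ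
  have hαI : α ∈ Icc (0 : ℝ) 1 := ⟨hα.le, hαβ.trans hβ.le⟩
  have hv₀ : 0 < v α := (hv.mem_unit 0 (by simp)).1.trans_lt (hv.strictMono (by simp) hαI hα)
  set L' := L * (1 + X * (2 + 1 / κ))
  have hL' : 0 < L' := by positivity
  set η := v α / (4 * X ^ 2 * c)
  have hη : 0 < η := by positivity
  have hτ : 0 < v α / (4 * L' * c * X) := by positivity
  -- The thresholds for the small-density moment and for `r N / √N` give each of these errors a
  -- quarter of the budget. They involve only bounds uniform on `[α, β]`, so `N₀` serves every `q`
  -- and `ε`.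
  have hev := (hrate.rate_atTop.eventually_gt_atTop 0).and <|
    (hrate.rate_slow.eventually_le_const hτ).and <| hrate.error_le.and <|
    (hrate.small_negligible.eventually_le_const (ENNReal.ofReal_pos.2 hη)).and <|
    eventually_gt_atTop 0
  obtain ⟨N₀, hN₀⟩ := eventually_atTop.1 hev
  refine ⟨N₀, fun N hN ε q hq hε _ hcond _ => ?_⟩
  obtain ⟨hr, hslow, herr, hsmall, hN0⟩ := hN₀ N hN
  have hqI : q ∈ Ioo (0 : ℝ) 1 := ⟨hα.trans_le hq.1, hq.2.trans_lt hβ⟩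
  have hqI' := Ioo_subset_Icc_self hqI
  have hb := h.isBidFunction
  have hρ := hw.allocRatio_pos hn hqI
  have hvα : v α ≤ v q := hv.strictMono.monotoneOn hαI hqI' hq.1
  rw [deriv_alloc_eq hb hqI, alloc_eq hb hqI'] at hcond
  have hcond' : 1 ≤ c * allocRatio n w q * r N * ε q := by
    have hD := hw.deriv_winProb_pos hn hqI
    rw [allocRatio, show c * (winProb (n - 1) w q / deriv (winProb (n - 1) w) q) * r N * ε q =
      c * winProb (n - 1) w q * r N * ε q / deriv (winProb (n - 1) w) q by ring, le_div_iff₀ hD]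
    linarith
  have hρe : allocRatio n w q * bidSlope n w v b q ≤ v q := by
    have := hw.bid_add_eq_value (v := v) (b := b) hn hqI
    linarith [h.nonneg q hqI']
  have hsd : smallDensityMoment κ b γ N q ≤ ENNReal.ofReal (η / r N) := by
    rw [ENNReal.ofReal_div_of_pos hr]
    refine (le_iSup₂_of_le (f := fun q _ => smallDensityMoment κ b γ N q) q hq le_rfl).trans ?_
    rw [ENNReal.le_div_iff_mul_le (Or.inl (ENNReal.ofReal_pos.2 hr).ne') (Or.inl (by simp)),
      mul_comm]
    exact hsmall
  have hS : 0 < √(N : ℝ) := Real.sqrt_pos.2 (by exact_mod_cast hN0)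
  have he := (h.bidSlope_pos hn hw hv hqI).le
  refine revenueMSE_div_le hqI.2 hε
    (error_budget hK hκ' hc hX hv₀ hvα (hv.mem_unit q hqI').2 hr he hρ (hρX q hq) hL' hε hS hρe
      hcond' hslow) ?_
  refine (eLpNorm_value_error_le hκ hκ1 hL hn hw hv h hqI (hρX q hq) (hbd q hq) hN0
    (hrate.measurable N)).trans ?_
  rw [ENNReal.ofReal_add (by positivity) (by positivity),
    ENNReal.ofReal_add (by positivity) (by positivity),
    ENNReal.ofReal_mul (p := allocRatio n w q * _) (q := K / r N) (by positivity),
    ENNReal.ofReal_mul (q := η / r N) hρ.le, ENNReal.ofReal_mul hL'.le]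
  gcongr
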